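/- Let $d$ be a dimension, $T>0$, and let $L^2(\mathbb R^d)$ consist of real- or complex-valued functions. Let $\mathcal L$ be a closed linear operator on $L^2(\mathbb R^d)$ with dense domain $D$ that generates a $C_0$-semigroup on $L^2(\mathbb R^d)$, let $f\in C([0,T];L^2(\mathbb R^d))$ be Lipschitz continuous in $t$, let $g\in D$, and let $q\in\mathcal D'(\mathbb R^d)$. A regularizing net of $q$ is a net $q_\varepsilon=q*\varphi_\varepsilon$, $\varepsilon\in(0,1]$, where $\varphi_\varepsilon(x)=l(\varepsilon)^{-d}\varphi(x/l(\varepsilon))$ for some $\varphi\in C_c^\infty(\mathbb R^d)$ with $\varphi\ge 0$, $\int\varphi=1$, and some positive function $l$ with $l(\varepsilon)\to0$ as $\varepsilon\to0$. It is of log-type if there is $N>0$ with $\|q_\varepsilon\|_{L^\infty(\mathbb R^d)}\le N\log\frac1\varepsilon$ for all sufficiently small $\varepsilon$. A net $(u_\varepsilon)_{\varepsilon\in(0,1]}$ in $C([0,T];D)$ (where $D$ carries the graph norm) is a very weak solution, with regularizing net $(q_\varepsilon)$, of the problem $\partial_tu-\mathcal Lu+qu=f$, $u(0)=g$, if for every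 $\varepsilon\in(0,1]$ $$\partial_tu_\varepsilon-\mathcal Lu_\varepsilon+q_\varepsilon u_\varepsilon=f\quad(t\in(0,T]),\qquad u_\varepsilon(0)=g,$$ with the time derivative taken in $L^2(\mathbb R^d)$, and if the net is moderate: there are $N\in\mathbb N_0$ and $C>0$ with $\sup_{t\in[0,T]}\|u_\varepsilon(t)\|_{L^2(\mathbb R^d)}\le C\varepsilon^{-N}$ for all $\varepsilon\in(0,1]$. **Theorem (Uniqueness).** Let $(q_\varepsilon)$ and $(\widetilde q_\varepsilon)$ be two regularizing nets of $q$, with $(q_\varepsilon)$ of log-type, such that for every $n\in\mathbb N$ there is $c>0$ with $$\|q_\varepsilon-\widetilde q_\varepsilon\|_{L^\infty(\mathbb R^d)}\le c\,\varepsilon^n\qquad\text{for all }\varepsilon\in(0,1].$$ Let $(u_\varepsilon)$ and $(\widetilde u_\varepsilon)$ be very weak solutions of $\partial_tu-\mathcal Lu+qu=f$, $u(0)=g$, with regularizing nets $(q_\varepsilon)$ and $(\widetilde q_\varepsilon)$ respectively. Then for every $k\in\mathbb N$ there is $C>0$ such that $$\sup_{t\in[0,T]}\|u_\varepsilon(t)-\widetilde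 u_\varepsilon(t)\|_{L^2(\mathbb R^d)}\le C\,\varepsilon^k\qquad\text{for all }\varepsilon\in(0,1].$$ -/

import Mathlib

open MeasureTheory Filter Topology Set
open scoped NNReal ENNReal Distributions

namespace VeryWeak

/-- The Euclidean space `ℝ^d`. -/
abbrev Space (d : ℕ) : Type := EuclideanSpace ℝ (Fin d)

/-- The space `L²(ℝ^d)` of `𝕜`-valued functions, `𝕜 = ℝ` or `ℂ`. -/
abbrev L2 (𝕜 : Type*) [RCLike 𝕜] (d : ℕ) : Type _ :=
  Lp 𝕜 2 (volume : Measure (Space d))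

/-! ### Strongly continuous semigroups and their generators -/

section Semigroup

variable {𝕜 X : Type*} [RCLike 𝕜] [NormedAddCommGroup X] [NormedSpace 𝕜 X]

/-- A `C₀`-semigroup of bounded linear operators. -/
structure IsC0Semigroup (S : ℝ≥0 → X →L[𝕜] X) : Prop where
  map_zero : S 0 = ContinuousLinearMap.id 𝕜 X
  map_add : ∀ s t : ℝ≥0, S (s + t) = (S s).comp (S t)
  tendsto_zero : ∀ x : X, Tendsto (fun t : ℝ≥0 => S t x) (𝓝 0) (𝓝 x)

/-- `L` is the infinitesimal generator of `S`: `x ∈ D(L)` and `L x = y` hold exactly when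
`(S h x - x) / h → y` as `h → 0+`. -/
def IsGenerator (L : X →ₗ.[𝕜] X) (S : ℝ≥0 → X →L[𝕜] X) : Prop :=
  ∀ x y : X, (x, y) ∈ L.graph ↔
    Tendsto (fun h : ℝ≥0 => (((h : ℝ) : 𝕜)⁻¹) • (S h x - x)) (𝓝[≠] 0) (𝓝 y)

/-- A closed operator with dense domain which generates a `C₀`-semigroup. -/
structure GeneratesC0Semigroup (L : X →ₗ.[𝕜] X) : Prop where
  closed : L.IsClosed
  dense : Dense (L.domain : Set X)
  generates : ∃ S : ℝ≥0 → X →L[𝕜] X, IsC0Semigroup S ∧ IsGenerator L S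

end Semigroup

/-! ### Regularization of distributions -/

section Regularization

variable {𝕜 : Type*} [RCLike 𝕜] {d : ℕ}

/-- The test function `y ↦ φ (x - y)`. -/
noncomputable def reflTranslate (φ : 𝓓((⊤ : TopologicalSpace.Opens (Space d)), ℝ)) (x : Space d) :
    𝓓((⊤ : TopologicalSpace.Opens (Space d)), ℝ) where
  toFun y := φ (x - y)
  contDiff' := φ.contDiff.comp (contDiff_const.sub contDiff_id)
  hasCompactSupport' := φ.hasCompactSupport.comp_homeomorph (Homeomorph.subLeft x)
  tsupport_subset' := fun _ _ => trivial

/-- The convolution `(q * φ)(x) = ⟨q, φ (x - ·)⟩` of a distribution with a test function. -/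
noncomputable def conv (q : 𝓓'((⊤ : TopologicalSpace.Opens (Space d)), 𝕜))
    (φ : 𝓓((⊤ : TopologicalSpace.Opens (Space d)), ℝ)) (x : Space d) : 𝕜 :=
  q (reflTranslate φ x)

/-- A mollifier: a nonnegative test function with integral one. -/
structure IsMollifier (φ : 𝓓((⊤ : TopologicalSpace.Opens (Space d)), ℝ)) : Prop where
  nonneg : ∀ x, 0 ≤ φ x
  integral_eq_one : ∫ x, φ x = 1

/-- A mollifying net: `φ_ε (x) = l(ε)^(-d) φ (x / l(ε))` for `ε ∈ (0,1]`, with a fixed mollifier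
`φ` and a positive function `l` with `l(ε) → 0` as `ε → 0`. -/
def IsMollifyingNet (φε : ℝ → 𝓓((⊤ : TopologicalSpace.Opens (Space d)), ℝ)) : Prop :=
  ∃ (φ : 𝓓((⊤ : TopologicalSpace.Opens (Space d)), ℝ)) (l : ℝ → ℝ),
    IsMollifier φ ∧ (∀ ε ∈ Ioc (0 : ℝ) 1, 0 < l ε) ∧ Tendsto l (𝓝[>] 0) (𝓝 0) ∧
      ∀ ε ∈ Ioc (0 : ℝ) 1, ∀ x : Space d, φε ε x = (l ε ^ d)⁻¹ * φ ((l ε)⁻¹ • x)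

/-- A regularizing net of the distribution `q`: `q_ε = q * φ_ε` for `ε ∈ (0,1]`, with a
mollifying net `φ_ε`. -/
def IsRegularizingNet (q : 𝓓'((⊤ : TopologicalSpace.Opens (Space d)), 𝕜))
    (qε : ℝ → Space d → 𝕜) : Prop :=
  ∃ φε : ℝ → 𝓓((⊤ : TopologicalSpace.Opens (Space d)), ℝ), IsMollifyingNet φε ∧
    ∀ ε ∈ Ioc (0 : ℝ) 1, qε ε = conv q (φε ε)

/-- A net of functions of log-type: `‖q_ε‖_{L^∞} ≤ N log (1/ε)` for all small `ε`. -/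
def IsLogType (qε : ℝ → Space d → 𝕜) : Prop :=
  ∃ N > (0 : ℝ), ∀ᶠ ε in 𝓝[>] (0 : ℝ),
    eLpNorm (qε ε) ∞ volume ≤ ENNReal.ofReal (N * Real.log (1 / ε))

end Regularization

/-- A moderate net `(b_ε)`, `ε ∈ (0,1]`, in a normed space. -/
def IsModerate {B : Type*} [NormedAddCommGroup B] (b : ℝ → B) : Prop :=
  ∃ (N : ℕ) (C : ℝ), 0 < C ∧ ∀ ε ∈ Ioc (0 : ℝ) 1, ‖b ε‖ ≤ C * (ε ^ N)⁻¹

/-! ### Solutions -/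

section Solutions

variable {𝕜 : Type*} [RCLike 𝕜] {d : ℕ}

/-- `u ∈ C([0,T]; D(L))` (continuity for the graph norm) solves
`∂ₜ u - L u + p u = f` on `(0,T] × ℝ^d`, `u(0) = g`. The time derivative is taken in `L²(ℝ^d)`
(one-sided at `t = T`), and the equation holds for every `t ∈ (0,T]` and almost every `x`. -/
structure IsSolution (L : L2 𝕜 d →ₗ.[𝕜] L2 𝕜 d) {T : ℝ} (hT : 0 < T) (p : Space d → 𝕜)
    (f : C(Icc (0 : ℝ) T, L2 𝕜 d)) (g : L2 𝕜 d) (u : C(Icc (0 : ℝ) T, L2 𝕜 d)) : Prop where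
  mem_domain : ∀ t, u t ∈ L.domain
  continuous_apply : Continuous fun t => L ⟨u t, mem_domain t⟩
  initial : u ⟨0, left_mem_Icc.2 hT.le⟩ = g
  equation : ∀ t : Icc (0 : ℝ) T, 0 < (t : ℝ) → ∃ u' : L2 𝕜 d,
    HasDerivWithinAt (IccExtend hT.le u) u' (Icc 0 T) (t : ℝ) ∧
      ∀ᵐ x, u' x - (L ⟨u t, mem_domain t⟩ : L2 𝕜 d) x + p x * u t x = f t x

/-- `(u_ε)` is a very weak solution of `∂ₜ u - L u + q u = f`, `u(0) = g`, with the
regularizing net `(q_ε)` of the potential `q`. -/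
structure IsVeryWeakSolutionWith (L : L2 𝕜 d →ₗ.[𝕜] L2 𝕜 d) {T : ℝ} (hT : 0 < T)
    (q : 𝓓'((⊤ : TopologicalSpace.Opens (Space d)), 𝕜)) (qε : ℝ → Space d → 𝕜)
    (f : C(Icc (0 : ℝ) T, L2 𝕜 d)) (g : L2 𝕜 d)
    (u : ℝ → C(Icc (0 : ℝ) T, L2 𝕜 d)) : Prop where
  regularizing : IsRegularizingNet q qε
  solution : ∀ ε ∈ Ioc (0 : ℝ) 1, IsSolution L hT (qε ε) f g (u ε)
  moderate : IsModerate u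

end Solutions

end VeryWeak

/-! Write `w` for the difference of the two solutions at a fixed `ε`. Then `w(0) = 0` and `w' - L w
= -q₁ w - (q₁ - q₂) u₂`. If `‖S t‖ ≤ M` on `[0,T]`, Duhamel and Gronwall give `‖w‖ ≤ M T ‖q₁ - q₂‖
‖u₂‖ exp (M T ‖q₁‖)`, with sup norms for the potentials (`IsSolution.norm_sub_le`). The log-type
bound makes the exponential at most a power of `1/ε`, moderateness does the same for `u₂`, and `q₁ -
q₂` decays faster than any power, so it absorbs both. This covers small `ε`; away from `0`
moderateness alone suffices (`IsModerate.exists_norm_sub_le`).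

Duhamel is used without vector-valued integrals: `s ↦ S (t - s) w(s)` is differentiated from the
right and its norm is compared with a scalar primitive. -/

namespace VeryWeak

/-! ### Bounds and joint continuity for `C₀`-semigroups -/

section Semigroup

variable {𝕜 X : Type*} [RCLike 𝕜] [NormedAddCommGroup X] [NormedSpace 𝕜 X]

namespace IsC0Semigroup

variable {S : ℝ≥0 → X →L[𝕜] X}

/-- Otherwise some `t n → 0` has `‖S (t n)‖ > n`, although every orbit converges along `t n`; this
contradicts Banach–Steinhaus. -/
theorem exists_bound_near_zero [CompleteSpace X] (hS : IsC0Semigroup S) :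
    ∃ δ > 0, ∃ M : ℝ, ∀ t ≤ δ, ‖S t‖ ≤ M := by
  by_contra! h
  have hpos : ∀ n : ℕ, (0 : ℝ≥0) < 1 / ((n : ℝ≥0) + 1) := fun n => by positivity
  choose t ht htn using fun n : ℕ => h _ (hpos n) n
  have hlim : Tendsto t atTop (𝓝 0) :=
    tendsto_of_tendsto_of_tendsto_of_le_of_le tendsto_const_nhds
      (tendsto_one_div_add_atTop_nhds_zero_nat (𝕜 := ℝ≥0)) (fun _ => zero_le) ht
  obtain ⟨C, hC⟩ := banach_steinhaus (g := fun n => S (t n)) fun x => by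
    obtain ⟨C, hC⟩ := (((hS.tendsto_zero x).comp hlim).norm).bddAbove_range
    exact ⟨C, fun n => hC ⟨n, rfl⟩⟩
  obtain ⟨n, hn⟩ := exists_nat_gt C
  exact absurd (hC n) (not_le.2 (hn.trans (htn n)))

theorem exists_bound [CompleteSpace X] (hS : IsC0Semigroup S) (T : ℝ≥0) :
    ∃ M > (0 : ℝ), ∀ t ≤ T, ‖S t‖ ≤ M := by
  obtain ⟨δ, hδ, M, hM⟩ := hS.exists_bound_near_zero
  have key : ∀ n : ℕ, ∃ C : ℝ, ∀ t ≤ n * δ, ‖S t‖ ≤ C := by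
    intro n
    induction n with
    | zero => exact ⟨M, fun t ht => hM t (ht.trans (by simp))⟩
    | succ n ih =>
      obtain ⟨C, hC⟩ := ih
      refine ⟨max M (M * C), fun t ht => ?_⟩
      rcases le_total t δ with h | h
      · exact (hM t h).trans (le_max_left _ _)
      · have h1 : S t = (S δ).comp (S (t - δ)) := by
          rw [← hS.map_add, add_tsub_cancel_of_le h]
        have h2 : ‖S (t - δ)‖ ≤ C := hC _ (by
          rw [tsub_le_iff_right]; push_cast at ht; linarith)
        rw [h1]
        refine ((S δ).opNorm_comp_le _).trans (le_trans ?_ (le_max_right _ _))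
        exact mul_le_mul (hM δ le_rfl) h2 (norm_nonneg _) ((norm_nonneg _).trans (hM δ le_rfl))
  obtain ⟨n, hn⟩ := exists_nat_ge (T / δ)
  obtain ⟨C, hC⟩ := key n
  refine ⟨max C 1, by positivity, fun t ht => (hC t (ht.trans ?_)).trans (le_max_left _ _)⟩
  rwa [div_le_iff₀ hδ] at hn

/-- Factoring out the operator at the smaller time reduces continuity at any time, from either side,
to continuity at `0`. -/
theorem norm_sub_le (hS : IsC0Semigroup S) {T : ℝ≥0} {M : ℝ} (hM : ∀ t ≤ T, ‖S t‖ ≤ M)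
    {s t : ℝ≥0} (hs : s ≤ T) (ht : t ≤ T) (x : X) :
    ‖S s x - S t x‖ ≤ M * ‖S (nndist s t) x - x‖ := by
  wlog h : t ≤ s generalizing s t
  · rw [norm_sub_rev, nndist_comm]
    exact this ht hs (not_le.1 h).le
  have h1 : nndist s t = s - t := by
    rw [NNReal.nndist_eq, tsub_eq_zero_of_le h]; simp
  have h2 : S s x = S t (S (s - t) x) := by
    rw [← ContinuousLinearMap.comp_apply, ← hS.map_add, add_tsub_cancel_of_le h]
  rw [h1, h2, ← map_sub]
  exact (S t).le_of_opNorm_le (hM t ht) _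

theorem continuous_uncurry [CompleteSpace X] (hS : IsC0Semigroup S) :
    Continuous fun p : ℝ≥0 × X => S p.1 p.2 := by
  rw [continuous_iff_continuousAt]
  rintro ⟨t, x⟩
  obtain ⟨M, -, hM⟩ := hS.exists_bound (t + 1)
  rw [ContinuousAt, tendsto_iff_norm_sub_tendsto_zero]
  have h1 : Tendsto (fun p : ℝ≥0 × X => M * ‖p.2 - x‖ + M * ‖S (nndist p.1 t) x - x‖)
      (𝓝 (t, x)) (𝓝 (M * ‖x - x‖ + M * ‖x - x‖)) := by
    refine Tendsto.add ?_ (Tendsto.const_mul _ (Tendsto.norm (Tendsto.sub_const ?_ _)))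
    · exact (((continuous_snd.sub continuous_const).norm.const_mul M).tendsto _)
    · refine (hS.tendsto_zero x).comp ?_
      have : Continuous fun p : ℝ≥0 × X => nndist p.1 t := by fun_prop
      simpa using this.tendsto (t, x)
  simp only [sub_self, norm_zero, mul_zero, add_zero] at h1
  refine squeeze_zero' (Eventually.of_forall fun _ => norm_nonneg _) ?_ h1
  have h2 : ∀ᶠ p : ℝ≥0 × X in 𝓝 (t, x), p.1 < t + 1 :=
    continuous_fst.tendsto (t, x) |>.eventually (gt_mem_nhds (by simp))
  filter_upwards [h2] with p hp
  have h3 : S p.1 p.2 - S t x = S p.1 (p.2 - x) + (S p.1 x - S t x) := by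
    rw [map_sub]; abel
  rw [h3]
  exact (norm_add_le _ _).trans (add_le_add ((S p.1).le_of_opNorm_le (hM _ hp.le) _)
    (hS.norm_sub_le hM hp.le (by simp) x))

/-- The derivative of `s ↦ S (t - s) w(s)`. -/
theorem hasDerivWithinAt_comp_sub [CompleteSpace X] [NormedSpace ℝ X] [IsScalarTower ℝ 𝕜 X]
    (hS : IsC0Semigroup S) {L : X →ₗ.[𝕜] X} (hL : IsGenerator L S) {w : ℝ → X} {w' y : X}
    {s t : ℝ} (hst : s < t) (hw : HasDerivWithinAt w w' (Ici s) s)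
    (hy : (w s, y) ∈ L.graph) :
    HasDerivWithinAt (fun r => S (t - r).toNNReal (w r)) (S (t - s).toNNReal (w' - y))
      (Ici s) s := by
  rw [← hasDerivWithinAt_Ioi_iff_Ici, hasDerivWithinAt_iff_tendsto_slope' self_notMem_Ioi] at hw ⊢
  have hgen : Tendsto (fun r : ℝ => (r - s)⁻¹ • (S (r - s).toNNReal (w s) - w s))
      (𝓝[>] s) (𝓝 y) := by
    have h1 : Tendsto (fun r : ℝ => (r - s).toNNReal) (𝓝[>] s) (𝓝[≠] 0) := by
      refine tendsto_nhdsWithin_iff.2 ⟨?_, ?_⟩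
      · have : Continuous fun r : ℝ => (r - s).toNNReal := by fun_prop
        simpa using this.continuousWithinAt.tendsto (s := Ioi s) (x := s)
      · filter_upwards [self_mem_nhdsWithin] with r hr
        simpa using hr
    refine (((hL _ _).1 hy).comp h1).congr' ?_
    filter_upwards [self_mem_nhdsWithin] with r hr
    have hr' : 0 ≤ r - s := (sub_pos.2 hr).le
    simp only [Function.comp_apply, Real.coe_toNNReal _ hr']
    rw [RCLike.real_smul_eq_coe_smul (K := 𝕜), RCLike.ofReal_inv]
  have hτ : Tendsto (fun r : ℝ => (t - r).toNNReal) (𝓝[>] s) (𝓝 (t - s).toNNReal) := by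
    have : Continuous fun r : ℝ => (t - r).toNNReal := by fun_prop
    exact this.continuousWithinAt.tendsto
  -- Since `S (t - s) = S (t - r) S (r - s)`, the difference quotient is `S (t - r)` applied to the
  -- slope of `w` minus `(r - s)⁻¹ (S (r - s) w(s) - w(s))`. Time and vector both vary with `r`,
  -- hence the need for joint continuity.
  refine ((hS.continuous_uncurry.tendsto ((t - s).toNNReal, w' - y)).comp
    (hτ.prodMk_nhds (hw.sub hgen))).congr' ?_
  filter_upwards [Ioo_mem_nhdsGT hst] with r hr
  have h2 : (t - s).toNNReal = (t - r).toNNReal + (r - s).toNNReal := by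
    rw [← Real.toNNReal_add (by linarith [hr.2]) (by linarith [hr.1])]
    congr 1; ring
  have hsmul : ∀ (c : ℝ) (x : X), S (t - r).toNNReal (c • x) = c • S (t - r).toNNReal x := by
    intro c x
    rw [RCLike.real_smul_eq_coe_smul (K := 𝕜), map_smul, RCLike.real_smul_eq_coe_smul (K := 𝕜)]
  simp only [Function.comp_apply, slope_def_module, ← smul_sub, hsmul, h2, hS.map_add,
    ContinuousLinearMap.comp_apply, ← map_sub]
  congr 2
  abel

end IsC0Semigroup

/-! ### Gronwall estimates and the Cauchy problem -/

/-- By `1 - exp (-z) ≤ z` with `z = K x`; the resulting bound has no division by `K`, so `K = 0`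
needs no separate form. -/
theorem gronwallBound_zero_le {K e x : ℝ} (hK : 0 ≤ K) (he : 0 ≤ e) :
    gronwallBound 0 K e x ≤ e * x * Real.exp (K * x) := by
  rcases hK.eq_or_lt with rfl | hK
  · simp [gronwallBound_K0]
  · simp only [gronwallBound_of_K_ne_0 hK.ne', zero_mul, zero_add]
    rw [div_mul_eq_mul_div,
      div_le_iff₀ hK]
    have h1 := Real.add_one_le_exp (-(K * x))
    have h2 : Real.exp (-(K * x)) * Real.exp (K * x) = 1 := by
      rw [← Real.exp_add]; simp
    have h3 : Real.exp (K * x) - 1 ≤ K * x * Real.exp (K * x) := by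
      nlinarith [Real.exp_pos (K * x)]
    nlinarith [mul_le_mul_of_nonneg_left h3 he]

/-- An integral inequality of Gronwall type. -/
theorem le_mul_exp_of_le_integral {y : ℝ → ℝ} (hy : Continuous y) {K e T : ℝ} (hK : 0 ≤ K)
    (he : 0 ≤ e) (h : ∀ t ∈ Icc 0 T, y t ≤ ∫ s in (0 : ℝ)..t, (K * y s + e)) :
    ∀ t ∈ Icc 0 T, y t ≤ e * t * Real.exp (K * t) := by
  intro t ht
  have hc : Continuous fun s => K * y s + e := by fun_prop
  have hd : ∀ t, HasDerivAt (fun t => ∫ s in (0 : ℝ)..t, (K * y s + e)) (K * y t + e) t :=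
    fun t => intervalIntegral.integral_hasDerivAt_right (hc.intervalIntegrable _ _)
      (hc.stronglyMeasurableAtFilter _ _) hc.continuousAt
  -- Gronwall is applied to the integral, which is differentiable and vanishes at `0`, because `y`
  -- itself is only continuous.
  have hg := le_gronwallBound_of_liminf_deriv_right_le (δ := 0) (K := K) (ε := e) (a := 0) (b := T)
    (f := fun t => ∫ s in (0 : ℝ)..t, (K * y s + e)) (f' := fun t => K * y t + e)
    (fun t _ => (hd t).continuousAt.continuousWithinAt)
    (fun t _ r hr => (hd t).hasDerivWithinAt.liminf_right_slope_le hr) (by simp)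
    (fun t ht => by
      have := mul_le_mul_of_nonneg_left (h t (Ico_subset_Icc_self ht)) hK
      linarith) t ht
  rw [sub_zero] at hg
  exact (h t ht).trans (hg.trans (gronwallBound_zero_le hK he))

/-- A priori estimate for the inhomogeneous Cauchy problem with zero initial value. -/
theorem IsC0Semigroup.norm_le_mul_exp [CompleteSpace X] [NormedSpace ℝ X] [IsScalarTower ℝ 𝕜 X]
    {S : ℝ≥0 → X →L[𝕜] X} (hS : IsC0Semigroup S) {L : X →ₗ.[𝕜] X} (hL : IsGenerator L S)
    {T M a b : ℝ} (hMpos : 0 ≤ M) (ha : 0 ≤ a) (hb : 0 ≤ b)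
    (hM : ∀ t ≤ T.toNNReal, ‖S t‖ ≤ M) {w : ℝ → X} (hw : Continuous w) (hw0 : w 0 = 0)
    (heq : ∀ t ∈ Ioo 0 T, ∃ w' y, HasDerivWithinAt w w' (Ici t) t ∧ (w t, y) ∈ L.graph ∧
      ‖w' - y‖ ≤ a * ‖w t‖ + b) :
    ∀ t ∈ Icc 0 T, ‖w t‖ ≤ M * b * t * Real.exp (M * a * t) := by
  refine le_mul_exp_of_le_integral hw.norm (mul_nonneg hMpos ha) (mul_nonneg hMpos hb) ?_
  intro t ht
  set F : ℝ → ℝ := fun t => ∫ s in (0 : ℝ)..t, (M * a * ‖w s‖ + M * b) with hF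
  have hc : Continuous fun s => M * a * ‖w s‖ + M * b := by fun_prop
  have hd : ∀ t, HasDerivAt F (M * a * ‖w t‖ + M * b) t :=
    fun t => intervalIntegral.integral_hasDerivAt_right (hc.intervalIntegrable _ _)
      (hc.stronglyMeasurableAtFilter _ _) hc.continuousAt
  have hFc : Continuous F := continuous_iff_continuousAt.2 fun t => (hd t).continuousAt
  have hF0 : F 0 = 0 := by simp [hF]
  rcases ht.1.eq_or_lt with rfl | ht0
  · simp [hw0]
  -- `v` runs from `S t (w 0) = 0` to `w t`, and its right derivative `S (t - r) (w' - y)` no longer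
  -- involves `L`.
  set v : ℝ → X := fun r => S (t - r).toNNReal (w r) with hv
  have hvc : Continuous v :=
    hS.continuous_uncurry.comp ((continuous_real_toNNReal.comp (by fun_prop)).prodMk hw)
  have hvt : v t = w t := by simp [hv, hS.map_zero]
  have hv0 : v 0 = 0 := by simp [hv, hw0]
  choose! w' y hw' hy hbd using heq
  -- The equation is not assumed at time `0`, so the comparison starts at `δ > 0` and `δ → 0` by
  -- continuity.
  have hmain : ∀ δ ∈ Ioo 0 t, ‖v t‖ ≤ ‖v δ‖ + (F t - F δ) := by
    intro δ hδ
    refine image_norm_le_of_norm_deriv_right_le_deriv_boundary (a := δ) (b := t)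
      (B := fun r => ‖v δ‖ + (F r - F δ)) (B' := fun r => M * a * ‖w r‖ + M * b)
      (f' := fun r => S (t - r).toNNReal (w' r - y r))
      hvc.continuousOn ?_ (by simp) (fun r => ((hd r).sub_const _).const_add _) ?_ ⟨hδ.2.le, le_rfl⟩
    · intro r hr
      have hr' : r ∈ Ioo 0 T := ⟨hδ.1.trans_le hr.1, hr.2.trans_le ht.2⟩
      exact hS.hasDerivWithinAt_comp_sub hL hr.2 (hw' r hr') (hy r hr')
    · intro r hr
      have hr' : r ∈ Ioo 0 T := ⟨hδ.1.trans_le hr.1, hr.2.trans_le ht.2⟩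
      have h1 := (S (t - r).toNNReal).le_of_opNorm_le
        (hM _ (Real.toNNReal_le_toNNReal (by linarith [hr'.1, ht.2]))) (w' r - y r)
      have h2 := mul_le_mul_of_nonneg_left (hbd r hr') hMpos
      linarith
  have hlim : Tendsto (fun δ => ‖v δ‖ + (F t - F δ)) (𝓝[>] 0) (𝓝 (‖v 0‖ + (F t - F 0))) := by
    have : Continuous fun δ => ‖v δ‖ + (F t - F δ) := by fun_prop
    exact this.continuousWithinAt.tendsto
  rw [hv0, hF0, norm_zero, zero_add, sub_zero] at hlim
  rw [← hvt]
  refine ge_of_tendsto hlim ?_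
  filter_upwards [Ioo_mem_nhdsGT ht0] with δ hδ using hmain δ hδ

end Semigroup

/-! ### Stability in `L²` and moderate nets -/

section Solutions

variable {𝕜 : Type*} [RCLike 𝕜] {d : ℕ}

/-- Lets products with potentials be estimated pointwise, without making multiplication by a
potential an operator on `L²`. -/
theorem norm_le_add_of_ae_le {α E : Type*} [MeasurableSpace α] {μ : Measure α}
    [NormedAddCommGroup E] {p : ℝ≥0∞} [Fact (1 ≤ p)] {a b : ℝ} (ha : 0 ≤ a) (hb : 0 ≤ b)
    {h w v : Lp E p μ} (hle : ∀ᵐ x ∂μ, ‖h x‖ ≤ a * ‖w x‖ + b * ‖v x‖) :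
    ‖h‖ ≤ a * ‖w‖ + b * ‖v‖ := by
  have hw : MemLp (fun x => a * ‖w x‖) p μ := (Lp.memLp w).norm.const_mul a
  have hv : MemLp (fun x => b * ‖v x‖) p μ := (Lp.memLp v).norm.const_mul b
  have h1 : ‖h‖ ≤ ‖hw.toLp + hv.toLp‖ := by
    refine Lp.norm_le_norm_of_ae_le ?_
    filter_upwards [hle, hw.coeFn_toLp, hv.coeFn_toLp, Lp.coeFn_add hw.toLp hv.toLp]
      with x hx h1 h2 h3
    rw [h3, Pi.add_apply, h1, h2]
    exact hx.trans (le_abs_self _)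
  refine h1.trans ((norm_add_le _ _).trans (add_le_add ?_ ?_))
  · refine Lp.norm_le_mul_norm_of_ae_le_mul ?_
    filter_upwards [hw.coeFn_toLp] with x hx
    rw [hx, norm_mul, norm_norm, Real.norm_of_nonneg ha]
  · refine Lp.norm_le_mul_norm_of_ae_le_mul ?_
    filter_upwards [hv.coeFn_toLp] with x hx
    rw [hx, norm_mul, norm_norm, Real.norm_of_nonneg hb]

theorem ae_norm_le_of_eLpNorm_top_le {α E : Type*} [MeasurableSpace α] {μ : Measure α}
    [NormedAddCommGroup E] {p : α → E} {a : ℝ} (ha : 0 ≤ a)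
    (h : eLpNorm p ∞ μ ≤ ENNReal.ofReal a) : ∀ᵐ x ∂μ, ‖p x‖ ≤ a := by
  rw [eLpNorm_exponent_top] at h
  filter_upwards [ae_le_eLpNormEssSup (f := p) (μ := μ)] with x hx
  have := hx.trans h
  rwa [← ofReal_norm, ENNReal.ofReal_le_ofReal_iff ha] at this

/-- Stability of solutions with respect to bounded perturbations of the potential. -/
theorem IsSolution.norm_sub_le {L : L2 𝕜 d →ₗ.[𝕜] L2 𝕜 d} {S : ℝ≥0 → L2 𝕜 d →L[𝕜] L2 𝕜 d}
    (hS : IsC0Semigroup S) (hL : IsGenerator L S) {T M a b : ℝ} (hT : 0 < T)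
    (hMpos : 0 ≤ M) (hM : ∀ t ≤ T.toNNReal, ‖S t‖ ≤ M) (ha : 0 ≤ a) (hb : 0 ≤ b)
    {p₁ p₂ : Space d → 𝕜} {f : C(Icc (0 : ℝ) T, L2 𝕜 d)} {g : L2 𝕜 d}
    {u₁ u₂ : C(Icc (0 : ℝ) T, L2 𝕜 d)}
    (h₁ : IsSolution L hT p₁ f g u₁) (h₂ : IsSolution L hT p₂ f g u₂)
    (hp : eLpNorm p₁ ∞ volume ≤ ENNReal.ofReal a)
    (hpp : eLpNorm (fun x => p₁ x - p₂ x) ∞ volume ≤ ENNReal.ofReal b) :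
    ‖u₁ - u₂‖ ≤ M * (b * ‖u₂‖) * T * Real.exp (M * a * T) := by
  have hp' := ae_norm_le_of_eLpNorm_top_le ha hp
  have hpp' := ae_norm_le_of_eLpNorm_top_le hb hpp
  rw [ContinuousMap.norm_le _ (by positivity)]
  rintro ⟨t, ht⟩
  have key := hS.norm_le_mul_exp hL hMpos ha (mul_nonneg hb (norm_nonneg u₂)) hM
    (w := fun t => IccExtend hT.le u₁ t - IccExtend hT.le u₂ t)
    (u₁.continuous.Icc_extend'.sub u₂.continuous.Icc_extend') ?_ ?_ t ht
  · simp only [IccExtend_of_mem hT.le _ ht] at key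
    refine key.trans ?_
    have := ht.2
    have := ht.1
    gcongr
  · rw [IccExtend_of_mem hT.le u₁ (left_mem_Icc.2 hT.le),
      IccExtend_of_mem hT.le u₂ (left_mem_Icc.2 hT.le), h₁.initial, h₂.initial, sub_self]
  · intro s hs
    have hs' : s ∈ Icc 0 T := Ioo_subset_Icc_self hs
    obtain ⟨u₁', hd₁, he₁⟩ := h₁.equation ⟨s, hs'⟩ hs.1
    obtain ⟨u₂', hd₂, he₂⟩ := h₂.equation ⟨s, hs'⟩ hs.1
    have hnhds : Icc 0 T ∈ 𝓝 s := Icc_mem_nhds hs.1 hs.2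
    refine ⟨u₁' - u₂', L ⟨u₁ ⟨s, hs'⟩, h₁.mem_domain _⟩ - L ⟨u₂ ⟨s, hs'⟩, h₂.mem_domain _⟩,
      ((hd₁.hasDerivAt hnhds).sub (hd₂.hasDerivAt hnhds)).hasDerivWithinAt, ?_, ?_⟩
    · simp only [IccExtend_of_mem hT.le _ hs']
      exact L.graph.sub_mem (L.mem_graph ⟨_, h₁.mem_domain _⟩) (L.mem_graph ⟨_, h₂.mem_domain _⟩)
    · simp only [IccExtend_of_mem hT.le _ hs']
      refine (norm_le_add_of_ae_le (v := u₂ ⟨s, hs'⟩) ha hb ?_).trans (by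
        gcongr; exact u₂.norm_coe_le_norm _)
      filter_upwards [hp', hpp', he₁, he₂, Lp.coeFn_sub u₁' u₂',
        Lp.coeFn_sub (u₁ ⟨s, hs'⟩) (u₂ ⟨s, hs'⟩),
        Lp.coeFn_sub (L ⟨u₁ ⟨s, hs'⟩, h₁.mem_domain _⟩) (L ⟨u₂ ⟨s, hs'⟩, h₂.mem_domain _⟩),
        Lp.coeFn_sub (u₁' - u₂')
          (L ⟨u₁ ⟨s, hs'⟩, h₁.mem_domain _⟩ - L ⟨u₂ ⟨s, hs'⟩, h₂.mem_domain _⟩)]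
        with x k1 k2 k3 k4 k5 k6 k7 k8
      rw [k8, Pi.sub_apply, k5, k7, k6]
      simp only [Pi.sub_apply]
      -- Splitting `p₁ u₁ - p₂ u₂` this way leaves only `p₁` as the coefficient of `u₁ - u₂`, so
      -- only the log-type net enters the exponential.
      have : u₁' x - u₂' x - ((L ⟨u₁ ⟨s, hs'⟩, h₁.mem_domain _⟩ : L2 𝕜 d) x
          - (L ⟨u₂ ⟨s, hs'⟩, h₂.mem_domain _⟩ : L2 𝕜 d) x)
          = -(p₁ x * (u₁ ⟨s, hs'⟩ x - u₂ ⟨s, hs'⟩ x)) - (p₁ x - p₂ x) * u₂ ⟨s, hs'⟩ x := by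
        linear_combination k3 - k4
      rw [this]
      refine (_root_.norm_sub_le _ _).trans ?_
      rw [norm_neg, norm_mul, norm_mul]
      gcongr

/-- Negligibility of a difference of moderate nets follows from its negligibility for small `ε`. -/
theorem IsModerate.exists_norm_sub_le {B : Type*} [NormedAddCommGroup B] {b₁ b₂ : ℝ → B}
    (h₁ : IsModerate b₁) (h₂ : IsModerate b₂) {k : ℕ} {C : ℝ} (hC : 0 ≤ C)
    (h : ∀ᶠ ε in 𝓝[>] (0 : ℝ), ‖b₁ ε - b₂ ε‖ ≤ C * ε ^ k) :
    ∃ C > (0 : ℝ), ∀ ε ∈ Ioc (0 : ℝ) 1, ‖b₁ ε - b₂ ε‖ ≤ C * ε ^ k := by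
  obtain ⟨N₁, C₁, hC₁, h₁⟩ := h₁
  obtain ⟨N₂, C₂, hC₂, h₂⟩ := h₂
  obtain ⟨δ, hδ, hsmall⟩ := mem_nhdsGT_iff_exists_Ioo_subset.1 h
  have hδ : 0 < δ := hδ
  -- `A` bounds the difference for `ε ≥ δ`, where also `ε ^ k ≥ δ ^ k`.
  set A := C₁ * (δ ^ N₁)⁻¹ + C₂ * (δ ^ N₂)⁻¹ with hA
  have hApos : 0 < A := by positivity
  refine ⟨C + A * (δ ^ k)⁻¹, by positivity, fun ε hε => ?_⟩
  have hε0 := hε.1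
  rcases lt_or_ge ε δ with hlt | hge
  · refine (hsmall ⟨hε.1, hlt⟩ : ‖b₁ ε - b₂ ε‖ ≤ C * ε ^ k).trans ?_
    gcongr
    exact le_add_of_nonneg_right (by positivity)
  · have h3 : ‖b₁ ε - b₂ ε‖ ≤ A := by
      refine (norm_sub_le _ _).trans (add_le_add ((h₁ ε hε).trans ?_) ((h₂ ε hε).trans ?_)) <;>
      gcongr
    have h4 : δ ^ k ≤ ε ^ k := by gcongr
    have h5 : A ≤ A * (δ ^ k)⁻¹ * ε ^ k := by
      rw [mul_assoc, inv_mul_eq_div]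
      exact le_mul_of_one_le_right hApos.le ((one_le_div (by positivity)).2 h4)
    refine h3.trans (h5.trans ?_)
    gcongr
    exact le_add_of_nonneg_left hC

/-- Rounding `A` up, harmless as the logarithm is nonnegative, gives a natural power that
negligibility can cancel. -/
theorem exp_mul_log_one_div_le {A ε : ℝ} (hε : 0 < ε) (hε1 : ε ≤ 1) :
    Real.exp (A * Real.log (1 / ε)) ≤ (ε ^ ⌈A⌉₊)⁻¹ := by
  have h0 : 0 ≤ Real.log (1 / ε) := Real.log_nonneg ((one_le_div hε).2 hε1)
  calc Real.exp (A * Real.log (1 / ε)) ≤ Real.exp (⌈A⌉₊ * Real.log (1 / ε)) := by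
        gcongr; exact Nat.le_ceil A
    _ = (ε ^ ⌈A⌉₊)⁻¹ := by
        rw [Real.exp_nat_mul, Real.exp_log (by positivity), one_div, inv_pow]

end Solutions

end VeryWeak

theorem mainTheorem7 {𝕜 : Type*} [RCLike 𝕜] {d : ℕ} {T : ℝ} (hT : 0 < T)
    (L : VeryWeak.L2 𝕜 d →ₗ.[𝕜] VeryWeak.L2 𝕜 d) (hL : VeryWeak.GeneratesC0Semigroup L)
    (f : C(Icc (0 : ℝ) T, VeryWeak.L2 𝕜 d)) (hf : ∃ K : ℝ≥0, LipschitzWith K f)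
    (g : VeryWeak.L2 𝕜 d) (hg : g ∈ L.domain)
    (q : 𝓓'((⊤ : TopologicalSpace.Opens (VeryWeak.Space d)), 𝕜))
    (q₁ q₂ : ℝ → VeryWeak.Space d → 𝕜)
    (hq₁ : VeryWeak.IsRegularizingNet q q₁) (hq₂ : VeryWeak.IsRegularizingNet q q₂)
    (hlog : VeryWeak.IsLogType q₁)
    (hneg : ∀ n : ℕ, ∃ c > (0 : ℝ), ∀ ε ∈ Ioc (0 : ℝ) 1,
      eLpNorm (fun x => q₁ ε x - q₂ ε x) ∞ volume ≤ ENNReal.ofReal (c * ε ^ n))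
    (u₁ u₂ : ℝ → C(Icc (0 : ℝ) T, VeryWeak.L2 𝕜 d))
    (hu₁ : VeryWeak.IsVeryWeakSolutionWith L hT q q₁ f g u₁)
    (hu₂ : VeryWeak.IsVeryWeakSolutionWith L hT q q₂ f g u₂) :
    ∀ k : ℕ, ∃ C > (0 : ℝ), ∀ ε ∈ Ioc (0 : ℝ) 1, ‖u₁ ε - u₂ ε‖ ≤ C * ε ^ k := by
  intro k
  obtain ⟨S, hS, hgen⟩ := hL.generates
  obtain ⟨M, hMpos, hM⟩ := hS.exists_bound T.toNNReal
  obtain ⟨N, hN, hlogN⟩ := hlog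
  obtain ⟨N₂, C₂, hC₂, hmod₂⟩ := hu₂.moderate
  set m := ⌈M * N * T⌉₊ with hm
  -- `N₂` pays for the growth of `u₂`, `m` for the exponential, and `k` is the rate left over.
  obtain ⟨c, hc, hcn⟩ := hneg (k + N₂ + m)
  refine hu₁.moderate.exists_norm_sub_le hu₂.moderate (C := M * c * C₂ * T) (by positivity) ?_
  filter_upwards [hlogN, Ioc_mem_nhdsGT (zero_lt_one' ℝ)] with ε hlogε hε
  have hε0 := hε.1
  have hl : 0 ≤ Real.log (1 / ε) := Real.log_nonneg ((one_le_div hε.1).2 hε.2)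
  have h1 := VeryWeak.IsSolution.norm_sub_le hS hgen hT hMpos.le hM (mul_nonneg hN.le hl)
    (by positivity) (hu₁.solution ε hε) (hu₂.solution ε hε) hlogε (hcn ε hε)
  have h2 : Real.exp (M * (N * Real.log (1 / ε)) * T) ≤ (ε ^ m)⁻¹ := by
    have := VeryWeak.exp_mul_log_one_div_le (A := M * N * T) hε.1 hε.2
    convert this using 2
    ring
  calc ‖u₁ ε - u₂ ε‖
      ≤ M * (c * ε ^ (k + N₂ + m) * (C₂ * (ε ^ N₂)⁻¹)) * T * (ε ^ m)⁻¹ := by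
        refine h1.trans ?_
        gcongr
        exact hmod₂ ε hε
    _ = M * c * C₂ * T * ε ^ k := by
        rw [pow_add, pow_add]
        field_simp
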